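/- Let $X$ be a real Banach space with norm $\|\cdot\|$ and unit sphere $S_X=\{x\in X:\|x\|=1\}$, and let $F\subseteq X^*$ be a linear subspace which is $1$-norming, i.e. $\|x\|=\sup\{f(x): f\in F,\ \|f\|\le 1\}$ for every $x\in X$. Let $\sigma(X,F)$ be the coarsest topology on $X$ for which every $f\in F$ is continuous. For $A\subseteq X$, a $\sigma(X,F)$-open slice of $A$ is a set of the form $A\cap\{x\in X: f(x)>r\}$, where $f\ne 0$ is a $\sigma(X,F)$-continuous linear functional on $X$ and $r\in\mathbb{R}$. We say that $(A,\sigma(X,F))$ has property $(*)$ with slices if there is a sequence $(\mathscr{U}_n)_{n\in\mathbb{N}}$ of families of $\sigma(X,F)$-open slices of $A$ such that for any distinct $x,y\in A$ there is $n\in\mathbb{N}$ for which (i) $\{x,y\}\cap\bigcup\mathscr{U}_n\neq\varnothing$, and (ii) $\{x,y\}\cap U$ contains at most one point for every $U\in\mathscr{U}_n$. Then the following are equivalent. 1. $X$ admits an equivalent norm $|||\cdot|||$ which is strictly convex (i.e. $|||x|||=|||y|||=|||\tfrac12(x+y)|||$ implies $x=y$) and lower semicontinuous with respect to $\sigma(X,F)$.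 2. $(X,\sigma(X,F))$ has property $(*)$ with slices. 3. $(S_X,\sigma(X,F))$ has property $(*)$ with slices. 4. There is a sequence $(X_n)_{n\in\mathbb{N}}$ of subsets of $X$ such that $$\{(x,y)\in X^2: x\ne y\}\subseteq\bigcup_{n\in\mathbb{N}}X_n^2$$ and $(X_n,\sigma(X,F))$ has property $(*)$ with slices for every $n$. -/

import Mathlib

namespace StarRenorming

section General

variable {S : Type*} [TopologicalSpace S]

/-- A sequence `U` of families of open subsets of a topological space `S` such that for any two
distinct points `x, y` some family `U n` covers at least one of the two points, while no member of
`U n` contains both. -/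
def IsStarSequence (U : ℕ → Set (Set S)) : Prop :=
  (∀ n, ∀ V ∈ U n, IsOpen V) ∧
    ∀ x y : S, x ≠ y →
      ∃ n, (({x, y} : Set S) ∩ ⋃₀ U n).Nonempty ∧
        ∀ V ∈ U n, (({x, y} : Set S) ∩ V).Subsingleton

variable {E : Type*} [AddCommGroup E] [Module ℝ E] [TopologicalSpace E]

/-- `V`, as a subset of `A`, is an open slice of `A`: the trace on `A` of an open half-space
`{x | r < f x}`, where `f` is a non-zero continuous linear functional on `E`. -/
def IsOpenSlice (A : Set E) (V : Set A) : Prop :=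
  ∃ f : E →L[ℝ] ℝ, f ≠ 0 ∧ ∃ r : ℝ, V = {a : A | r < f (a : E)}

/-- The subset `A` of `E`, with its relative topology, has property (*) with slices. -/
def HasStarWithSlices (A : Set E) : Prop :=
  ∃ U : ℕ → Set (Set A), IsStarSequence U ∧ ∀ n, ∀ V ∈ U n, IsOpenSlice A V

end General

section Normed

variable {X : Type*} [NormedAddCommGroup X] [NormedSpace ℝ X]

/-- The topology `σ(X, F)`: the coarsest topology on `X` making every element of `F`
continuous. -/
abbrev sigmaTopology (F : Submodule ℝ (StrongDual ℝ X)) : TopologicalSpace X :=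
  ⨅ f : F, TopologicalSpace.induced (fun x : X => (f : StrongDual ℝ X) x) inferInstance

/-- `F` is 1-norming: `‖x‖ = sup {f x | f ∈ F, ‖f‖ ≤ 1}` for every `x`. -/
def IsOneNorming (F : Submodule ℝ (StrongDual ℝ X)) : Prop :=
  ∀ x : X, IsLUB {t : ℝ | ∃ f ∈ F, ‖f‖ ≤ 1 ∧ f x = t} ‖x‖

/-- The seminorm `p` is an equivalent norm on `X`. -/
def IsEquivalentNorm (p : Seminorm ℝ X) : Prop :=
  ∃ c C : ℝ, 0 < c ∧ 0 < C ∧ ∀ x : X, c * ‖x‖ ≤ p x ∧ p x ≤ C * ‖x‖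

/-- Strict convexity of (the norm) `p`: `p x = p y = p ((x + y) / 2)` forces `x = y`. -/
def IsStrictlyConvexNorm (p : Seminorm ℝ X) : Prop :=
  ∀ x y : X, p x = p y → p y = p ((1 / 2 : ℝ) • (x + y)) → x = y

/-- `(A, σ(X, F))` has property (*) with slices. -/
def SigmaHasStarWithSlices (F : Submodule ℝ (StrongDual ℝ X)) (A : Set X) : Prop :=
  @HasStarWithSlices X _ _ (sigmaTopology F) A

end Normed

end StarRenorming

namespace StarRenorming

/-! ### From a strictly convex lower semicontinuous norm to slices. -/

section StrictlyConvexToStar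

variable {E : Type*} [AddCommGroup E] [Module ℝ E] [TopologicalSpace E]

/-! Given a norm `p` as in 1, use for each rational `q` the slices of `X` on which `p > q`. For `x ≠
y` strict convexity gives a rational `q` with `p ((x + y) / 2) < q < max (p x) (p y)`. Hahn–Banach
cuts the point of larger norm off the closed convex set `{p ≤ q}`, while a slice containing both
points would contain the midpoint.

Conversely, a family of half-spaces `r * t < f` yields the convex, lower semicontinuous function
`supExcess`, the supremum of the normalised positive parts of `f - r * t`. If it has the same
positive value at `x`, `y` and their midpoint, a half-space nearly attaining the supremum at the
midpoint contains both `x` and `y` (`exists_mem_both_of_supExcess_eq`), which property (*) forbids.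
Countably many such functions are merged into `Φ x = ‖x‖ ^ 2 + G x + G (-x)`, with `G` a weighted
sum of squares, and the new norm is the gauge of a sublevel set of `Φ`. The parameter `t` carries
slices of the unit sphere to every sphere of radius `t`; for a cover of pairs, `t = 1` suffices. -/

lemma IsOpenSlice.isOpen {A : Set E} {V : Set A} (hV : IsOpenSlice A V) : IsOpen V := by
  obtain ⟨f, -, r, rfl⟩ := hV
  exact isOpen_lt continuous_const (f.continuous.comp continuous_subtype_val)

lemma HasStarWithSlices.mono {A B : Set E} (hAB : A ⊆ B) (hB : HasStarWithSlices B) :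
    HasStarWithSlices A := by
  obtain ⟨U, ⟨-, hU⟩, hslice⟩ := hB
  have key : ∀ n, ∀ V ∈ (fun W : Set B => {a : A | (⟨a, hAB a.2⟩ : B) ∈ W}) '' U n,
      IsOpenSlice A V := by
    rintro n _ ⟨W, hW, rfl⟩
    obtain ⟨f, hf, r, rfl⟩ := hslice n W hW
    exact ⟨f, hf, r, rfl⟩
  refine ⟨fun n => (fun W : Set B => {a : A | (⟨a, hAB a.2⟩ : B) ∈ W}) '' U n,
    ⟨fun n V hV => (key n V hV).isOpen, fun x y hxy => ?_⟩, key⟩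
  obtain ⟨n, ⟨z, hz, W, hW, hzW⟩, hsub⟩ := hU ⟨x, hAB x.2⟩ ⟨y, hAB y.2⟩
    (fun h => hxy (Subtype.ext (Subtype.mk.inj h)))
  refine ⟨n, ?_, ?_⟩
  · rcases hz with rfl | rfl
    · exact ⟨x, Or.inl rfl, _, ⟨W, hW, rfl⟩, hzW⟩
    · exact ⟨y, Or.inr rfl, _, ⟨W, hW, rfl⟩, hzW⟩
  · rintro _ ⟨W, hW, rfl⟩ a ⟨ha, haW⟩ b ⟨hb, hbW⟩
    have hmem : ∀ c : A, c ∈ ({x, y} : Set A) →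
        (⟨c, hAB c.2⟩ : B) ∈ ({⟨x, hAB x.2⟩, ⟨y, hAB y.2⟩} : Set B) := by
      rintro c (rfl | rfl)
      · exact Or.inl rfl
      · exact Or.inr rfl
    have := hsub W hW ⟨hmem a ha, haW⟩ ⟨hmem b hb, hbW⟩
    exact Subtype.ext (Subtype.mk.inj this)

lemma hasStarWithSlices_univ_of_seminorm [IsTopologicalAddGroup E] [ContinuousSMul ℝ E]
    [LocallyConvexSpace ℝ E] (p : Seminorm ℝ E) (hlsc : LowerSemicontinuous fun x => p x)
    (hp : ∀ x y, p x = p y → p y = p ((1 / 2 : ℝ) • (x + y)) → x = y) :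
    HasStarWithSlices (Set.univ : Set E) := by
  obtain ⟨q, hq⟩ := exists_surjective_nat ℚ
  refine ⟨fun n => {V | IsOpenSlice Set.univ V ∧ ∀ a ∈ V, (q n : ℝ) < p a},
    ⟨fun n V hV => hV.1.isOpen, fun x y hxy => ?_⟩, fun n V hV => hV.1⟩
  have hmid : p ((1 / 2 : ℝ) • ((x : E) + y)) ≤ (p x + p y) / 2 := by
    rw [map_smul_eq_mul, Real.norm_of_nonneg (by norm_num)]
    linarith [map_add_le_add p (x : E) y]
  have hlt : p ((1 / 2 : ℝ) • ((x : E) + y)) < max (p x) (p y) := by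
    rcases lt_trichotomy (p (x : E)) (p y) with h | h | h
    · exact lt_max_of_lt_right (by linarith)
    · refine lt_max_of_lt_right (lt_of_le_of_ne (by linarith) fun h' => hxy ?_)
      exact Subtype.ext (hp x y h h'.symm)
    · exact lt_max_of_lt_left (by linarith)
  obtain ⟨r, hr₁, hr₂⟩ := exists_rat_btwn hlt
  obtain ⟨n, rfl⟩ := hq r
  refine ⟨n, ?_, ?_⟩
  · obtain ⟨z, hz, hqz⟩ : ∃ z ∈ ({x, y} : Set (Set.univ : Set E)), (q n : ℝ) < p z := by
      rcases lt_max_iff.1 hr₂ with h | h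
      · exact ⟨x, Or.inl rfl, h⟩
      · exact ⟨y, Or.inr rfl, h⟩
    have hconv : Convex ℝ {a | p a ≤ (q n : ℝ)} := by
      simpa using p.convexOn.convex_le (q n : ℝ)
    obtain ⟨f, u, hfu, hu⟩ := geometric_hahn_banach_closed_point hconv
      (hlsc.isClosed_preimage (q n : ℝ)) (x := (z : E)) (by simpa using hqz)
    -- The origin lies in the sublevel set, so `0 < u`; this rules out `f = 0`.
    have h0 : (0 : ℝ) < u := by
      simpa using hfu 0 (by simpa using ((apply_nonneg p _).trans hr₁.le))
    refine ⟨z, hz, {a | u < f a}, ⟨⟨f, ?_, u, rfl⟩, fun a ha => ?_⟩, hu⟩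
    · rintro rfl
      simp at hu
      linarith
    · by_contra hcon
      exact lt_asymm ha (hfu a (not_lt.1 hcon))
  · rintro V ⟨⟨f, -, u, rfl⟩, hV⟩
    have hnot : ¬ (u < f x ∧ u < f y) := by
      rintro ⟨h₁, h₂⟩
      refine lt_asymm hr₁ (hV ⟨(1 / 2 : ℝ) • ((x : E) + y), trivial⟩ ?_)
      simp only [Set.mem_ofPred_eq, map_smul, map_add, smul_eq_mul]
      linarith
    rintro a ⟨rfl | rfl, ha'⟩ b ⟨rfl | rfl, hb'⟩
    · rfl
    · exact absurd ⟨ha', hb'⟩ hnot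
    · exact absurd ⟨hb', ha'⟩ hnot
    · rfl

end StrictlyConvexToStar

/-! ### Strictly convex norms as gauges of sublevel sets. -/

section Gauge

variable {X : Type*} [NormedAddCommGroup X] [NormedSpace ℝ X]

/-- On the gauge's unit sphere `Φ` is constantly 17, so `hstrict` applies there; homogeneity does
the rest. The level 17 is `1 + 4 * 2 ^ 2`, the bound of `hup` on the unit ball, and `17 < 5 ^ 2`
bounds the sublevel set. -/
lemma exists_strictlyConvexNorm_of_convexOn {Φ : X → ℝ}
    (hconv : ConvexOn ℝ Set.univ Φ) (heven : ∀ x, Φ (-x) = Φ x) (hlow : ∀ x, ‖x‖ ^ 2 ≤ Φ x)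
    (hup : ∀ x, Φ x ≤ ‖x‖ ^ 2 + 4 * (1 + ‖x‖) ^ 2)
    (hstrict : ∀ x y, Φ x = Φ y → Φ y = Φ ((1 / 2 : ℝ) • (x + y)) → x = y) :
    ∃ p : Seminorm ℝ X, IsEquivalentNorm p ∧ IsStrictlyConvexNorm p ∧
      ∀ t : ℝ, 0 < t → ∀ x, p x ≤ t ↔ Φ (t⁻¹ • x) ≤ 17 := by
  have hcont : Continuous Φ := by
    rw [← continuousOn_univ]
    -- A convex function bounded above near one point is continuous.
    refine ((ConvexOn.continuousOn_tfae isOpen_univ Set.univ_nonempty hconv).out 3 1).1 ?_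
    refine ⟨0, Set.mem_univ _, 17, ?_⟩
    rw [Filter.eventually_map]
    filter_upwards [Metric.ball_mem_nhds (0 : X) one_pos] with x hx
    have hx : ‖x‖ < 1 := by simpa using hx
    nlinarith [hup x, norm_nonneg x]
  set s : Set X := {x | Φ x ≤ 17} with hs
  have hsc : Convex ℝ s := by simpa using hconv.convex_le 17
  have hball : Metric.ball (0 : X) 1 ⊆ s := fun x hx => by
    have hx : ‖x‖ < 1 := by simpa using hx
    change Φ x ≤ 17
    nlinarith [hup x, norm_nonneg x]
  have hs0 : s ∈ nhds 0 := Filter.mem_of_superset (Metric.ball_mem_nhds _ one_pos) hball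
  have hcl : IsClosed s := isClosed_le hcont continuous_const
  have hneg : ∀ x ∈ s, -x ∈ s := fun x hx => by
    change Φ (-x) ≤ 17
    rw [heven]; exact hx
  have hbal : Balanced ℝ s := by
    rw [balanced_iff_smul_mem]
    intro a ha x hx
    have h0 := mem_of_mem_nhds hs0
    rw [Real.norm_eq_abs] at ha
    rcases le_total 0 a with h | h
    · rw [abs_of_nonneg h] at ha
      exact hsc.smul_mem_of_zero_mem h0 hx ⟨h, ha⟩
    · rw [abs_of_nonpos h] at ha
      simpa using hsc.smul_mem_of_zero_mem h0 (hneg x hx) ⟨neg_nonneg.2 h, ha⟩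
  have habs : Absorbent ℝ s := absorbent_nhds_zero hs0
  have hsub : s ⊆ Metric.closedBall 0 5 := fun x hx => by
    have hx : Φ x ≤ 17 := hx
    rw [mem_closedBall_zero_iff]
    nlinarith [hlow x]
  have hle_one : ∀ x, gauge s x ≤ 1 ↔ Φ x ≤ 17 := fun x => by
    rw [gauge_le_one_iff_mem_closure hsc hs0, hcl.closure_eq]; rfl
  have heq_one : ∀ x, gauge s x = 1 → Φ x = 17 := fun x hx => by
    refine le_antisymm ((hle_one x).1 hx.le) (not_lt.1 fun hlt => hx.not_lt ?_)
    exact (gauge_lt_one_iff_mem_interior hsc hs0).2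
      (mem_interior.2 ⟨{y | Φ y < 17}, fun y (hy : Φ y < 17) => hy.le,
        isOpen_lt hcont continuous_const, hlt⟩)
  have hle : ∀ t : ℝ, 0 < t → ∀ x, gauge s x ≤ t ↔ Φ (t⁻¹ • x) ≤ 17 := fun t ht x => by
    rw [← hle_one, gauge_smul_of_nonneg (inv_nonneg.2 ht.le), smul_eq_mul, inv_mul_le_one₀ ht]
  refine ⟨gaugeSeminorm hbal hsc habs, ⟨5⁻¹, 1, by norm_num, one_pos, fun x => ⟨?_, ?_⟩⟩, ?_, hle⟩
  · have := le_gauge_of_subset_closedBall habs (by norm_num) hsub (x := x)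
    change 5⁻¹ * ‖x‖ ≤ gauge s x
    linarith
  · have := mul_gauge_le_norm hball (x := x)
    change gauge s x ≤ 1 * ‖x‖
    linarith
  · intro x y hxy hm
    change gauge s x = gauge s y at hxy
    change gauge s y = gauge s ((1 / 2 : ℝ) • (x + y)) at hm
    have hzero : ∀ z, gauge s z = 0 → z = 0 := fun z hz => by
      have := le_gauge_of_subset_closedBall habs (by norm_num) hsub (x := z)
      rw [← norm_le_zero_iff]
      linarith
    rcases (gauge_nonneg (s := s) y).eq_or_lt with h | h
    · rw [hzero x (by rw [hxy, ← h]), hzero y h.symm]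
    · have hscale : ∀ z, gauge s z = gauge s y → Φ ((gauge s y)⁻¹ • z) = 17 := fun z hz => by
        apply heq_one
        rw [gauge_smul_of_nonneg (inv_nonneg.2 h.le), smul_eq_mul, hz, inv_mul_cancel₀ h.ne']
      have key := hstrict ((gauge s y)⁻¹ • x) ((gauge s y)⁻¹ • y)
        (by rw [hscale x hxy, hscale y rfl])
        (by rw [← smul_add, smul_comm, hscale y rfl, hscale _ hm.symm])
      exact smul_right_injective X (inv_ne_zero h.ne') key

lemma lowerSemicontinuous_seminorm_of_sublevel {Y : Type*} [AddCommGroup Y] [Module ℝ Y]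
    [TopologicalSpace Y] (hsmul : ∀ t : ℝ, Continuous fun x : Y => t • x) {Φ : Y → ℝ}
    (hlsc : LowerSemicontinuous Φ) {c : ℝ} (p : Seminorm ℝ Y)
    (hp : ∀ t : ℝ, 0 < t → ∀ x, p x ≤ t ↔ Φ (t⁻¹ • x) ≤ c) :
    LowerSemicontinuous fun x => p x := by
  intro x a hax
  rcases lt_or_ge a 0 with ha | ha
  · exact Filter.Eventually.of_forall fun y => ha.trans_le (apply_nonneg p y)
  · obtain ⟨t, hat, htx⟩ := exists_between hax
    have ht : 0 < t := ha.trans_lt hat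
    have hx : c < Φ (t⁻¹ • x) := by rwa [← not_le, ← hp t ht, not_le]
    filter_upwards [hlsc.comp (hsmul t⁻¹) x c hx] with y hy
    have : t < p y := by rw [← not_le, hp t ht]; exact not_le.2 hy
    exact hat.trans this

end Gauge

/-! ### Weighted sums of squares of convex functions. -/

section Sum

lemma convexOn_tsum {X : Type*} [AddCommGroup X] [Module ℝ X] {g : ℕ → X → ℝ}
    (hg : ∀ k, ConvexOn ℝ Set.univ (g k)) (hsum : ∀ x, Summable fun k => g k x) :
    ConvexOn ℝ Set.univ fun x => ∑' k, g k x := by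
  refine ⟨convex_univ, fun x _ y _ a b ha hb hab => ?_⟩
  simp only [smul_eq_mul]
  rw [← tsum_mul_left, ← tsum_mul_left, ← ((hsum x).mul_left a).tsum_add ((hsum y).mul_left b)]
  exact (hsum _).tsum_le_tsum (fun k => (hg k).2 (Set.mem_univ _) (Set.mem_univ _) ha hb hab)
    (((hsum x).mul_left a).add ((hsum y).mul_left b))

lemma lowerSemicontinuous_tsum_of_nonneg {Y : Type*} [TopologicalSpace Y] {g : ℕ → Y → ℝ}
    (hg : ∀ k, LowerSemicontinuous (g k)) (h0 : ∀ k x, 0 ≤ g k x)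
    (hsum : ∀ x, Summable fun k => g k x) : LowerSemicontinuous fun x => ∑' k, g k x := by
  intro x a ha
  obtain ⟨s, hs⟩ := ((hsum x).hasSum.eventually (lt_mem_nhds ha)).exists
  filter_upwards [lowerSemicontinuous_sum (fun k _ => hg k) (a := s) x a (by simpa using hs)]
    with y hy
  exact (show a < ∑ k ∈ s, g k y by simpa using hy).trans_le
    ((hsum y).sum_le_tsum s fun k _ => h0 k y)

lemma lowerSemicontinuous_sq {Y : Type*} [TopologicalSpace Y] {φ : Y → ℝ}
    (hφ : LowerSemicontinuous φ) (h0 : ∀ x, 0 ≤ φ x) : LowerSemicontinuous fun x => φ x ^ 2 := by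
  -- Truncation at 0 makes squaring monotone on all of `ℝ`.
  have hc : Continuous fun t : ℝ => max t 0 ^ 2 := by fun_prop
  have hm : Monotone fun t : ℝ => max t 0 ^ 2 := fun s t hst =>
    pow_le_pow_left₀ (le_max_right _ _) (max_le_max hst le_rfl) 2
  have heq : (fun x => φ x ^ 2) = (fun t : ℝ => max t 0 ^ 2) ∘ φ := by
    ext x
    simp [max_eq_left (h0 x)]
  rw [heq]
  exact hc.comp_lowerSemicontinuous hφ hm

lemma lowerSemicontinuous_const_mul {Y : Type*} [TopologicalSpace Y] {φ : Y → ℝ}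
    (hφ : LowerSemicontinuous φ) {c : ℝ} (hc : 0 ≤ c) : LowerSemicontinuous fun x => c * φ x :=
  (show Continuous fun t : ℝ => c * t by fun_prop).comp_lowerSemicontinuous hφ
    fun _ _ hst => mul_le_mul_of_nonneg_left hst hc

/-- This is where squares matter: `2 * (a ^ 2 + b ^ 2) = (a + b) ^ 2 + (a - b) ^ 2` turns equality
in midpoint convexity into equality of values. -/
lemma eq_and_eq_of_sq_add_sq_le {a b m : ℝ} (hm : 0 ≤ m) (hle : m ≤ (a + b) / 2)
    (h : a ^ 2 + b ^ 2 ≤ 2 * m ^ 2) : a = b ∧ b = m := by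
  have hab : a = b := by
    have : (a - b) ^ 2 ≤ 0 := by nlinarith
    exact sub_eq_zero.1 (pow_eq_zero_iff two_ne_zero |>.1 (le_antisymm this (sq_nonneg _)))
  subst hab
  refine ⟨rfl, ?_⟩
  nlinarith

variable {X : Type*} [NormedAddCommGroup X]

/-- The weighted square sum of a sequence of functions. -/
noncomputable def weightedSqSum {Y : Type*} (ψ : ℕ → Y → ℝ) (x : Y) : ℝ :=
  ∑' k, (1 / 2 : ℝ) ^ k * ψ k x ^ 2

lemma summable_weightedSq {ψ : ℕ → X → ℝ} (h0 : ∀ k x, 0 ≤ ψ k x)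
    (hle : ∀ k x, ψ k x ≤ 1 + ‖x‖) (x : X) :
    Summable fun k => (1 / 2 : ℝ) ^ k * ψ k x ^ 2 :=
  Summable.of_nonneg_of_le (fun k => by positivity)
    (fun k => mul_le_mul_of_nonneg_left (pow_le_pow_left₀ (h0 k x) (hle k x) 2) (by positivity))
    (summable_geometric_two.mul_right ((1 + ‖x‖) ^ 2))

lemma weightedSqSum_nonneg {Y : Type*} (ψ : ℕ → Y → ℝ) (x : Y) : 0 ≤ weightedSqSum ψ x :=
  tsum_nonneg fun k => by positivity

lemma weightedSqSum_le {ψ : ℕ → X → ℝ} (h0 : ∀ k x, 0 ≤ ψ k x)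
    (hle : ∀ k x, ψ k x ≤ 1 + ‖x‖) (x : X) : weightedSqSum ψ x ≤ 2 * (1 + ‖x‖) ^ 2 := by
  rw [← tsum_geometric_two, ← tsum_mul_right]
  exact (summable_weightedSq h0 hle x).tsum_le_tsum
    (fun k => mul_le_mul_of_nonneg_left (pow_le_pow_left₀ (h0 k x) (hle k x) 2) (by positivity))
    (summable_geometric_two.mul_right ((1 + ‖x‖) ^ 2))

variable [NormedSpace ℝ X]

lemma convexOn_midpoint_le {φ : X → ℝ} (hφ : ConvexOn ℝ Set.univ φ) (x y : X) :
    φ ((1 / 2 : ℝ) • (x + y)) ≤ (φ x + φ y) / 2 := by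
  have := hφ.2 (Set.mem_univ x) (Set.mem_univ y) (show (0 : ℝ) ≤ 1 / 2 by norm_num)
    (show (0 : ℝ) ≤ 1 / 2 by norm_num) (by norm_num)
  rw [smul_add]
  simp only [smul_eq_mul] at this
  linarith

lemma convexOn_weightedSq {φ : X → ℝ} (h0 : ∀ x, 0 ≤ φ x) (hconv : ConvexOn ℝ Set.univ φ)
    (k : ℕ) : ConvexOn ℝ Set.univ fun x => (1 / 2 : ℝ) ^ k * φ x ^ 2 :=
  (hconv.pow (fun x _ => h0 x) 2).smul (by positivity)

lemma convexOn_weightedSqSum {ψ : ℕ → X → ℝ} (h0 : ∀ k x, 0 ≤ ψ k x)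
    (hle : ∀ k x, ψ k x ≤ 1 + ‖x‖) (hconv : ∀ k, ConvexOn ℝ Set.univ (ψ k)) :
    ConvexOn ℝ Set.univ (weightedSqSum ψ) :=
  convexOn_tsum (fun k => convexOn_weightedSq (h0 k) (hconv k) k) (summable_weightedSq h0 hle)

lemma eq_midpoint_of_weightedSqSum {ψ : ℕ → X → ℝ} (h0 : ∀ k x, 0 ≤ ψ k x)
    (hle : ∀ k x, ψ k x ≤ 1 + ‖x‖) (hconv : ∀ k, ConvexOn ℝ Set.univ (ψ k)) {x y : X}
    (h : weightedSqSum ψ x + weightedSqSum ψ y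
      ≤ 2 * weightedSqSum ψ ((1 / 2 : ℝ) • (x + y))) (k : ℕ) :
    ψ k x = ψ k y ∧ ψ k y = ψ k ((1 / 2 : ℝ) • (x + y)) := by
  have hs := summable_weightedSq h0 hle
  have hmid : ∀ k, 0 ≤ (1 / 2 : ℝ) ^ k * ψ k x ^ 2 + (1 / 2 : ℝ) ^ k * ψ k y ^ 2
      - 2 * ((1 / 2 : ℝ) ^ k * ψ k ((1 / 2 : ℝ) • (x + y)) ^ 2) := fun k => by
    have := convexOn_midpoint_le (convexOn_weightedSq (h0 k) (hconv k) k) x y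
    linarith
  have hsum := ((hs x).hasSum.add (hs y).hasSum).sub ((hs ((1 / 2 : ℝ) • (x + y))).hasSum.mul_left 2)
  -- The midpoint defects are nonnegative with sum at most 0, so each vanishes.
  have hzero := le_antisymm (sub_nonpos.2 h) (hsum.nonneg hmid)
  have hk := congrFun ((hasSum_zero_iff_of_nonneg hmid).1 (hzero ▸ hsum)) k
  refine eq_and_eq_of_sq_add_sq_le (h0 k _) (convexOn_midpoint_le (hconv k) x y) ?_
  have hpos : (0 : ℝ) < (1 / 2) ^ k := by positivity
  simp only [Pi.zero_apply] at hk
  refine le_of_mul_le_mul_left ?_ hpos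
  linarith

lemma lowerSemicontinuous_weightedSqSum {Y : Type*} [TopologicalSpace Y] {ψ : ℕ → Y → ℝ}
    (h0 : ∀ k x, 0 ≤ ψ k x) (hsum : ∀ x, Summable fun k => (1 / 2 : ℝ) ^ k * ψ k x ^ 2)
    (hlsc : ∀ k, LowerSemicontinuous (ψ k)) : LowerSemicontinuous (weightedSqSum ψ) := by
  refine lowerSemicontinuous_tsum_of_nonneg (fun k => ?_) (fun k x => by positivity) hsum
  exact lowerSemicontinuous_const_mul (lowerSemicontinuous_sq (hlsc k) (h0 k)) (by positivity)

lemma lowerSemicontinuous_sq_add_add_comp {Y : Type*} [TopologicalSpace Y] {N G : Y → ℝ}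
    {i : Y → Y} (hN : LowerSemicontinuous N) (hN0 : ∀ x, 0 ≤ N x) (hG : LowerSemicontinuous G)
    (hi : Continuous i) : LowerSemicontinuous fun x => N x ^ 2 + G x + G (i x) :=
  ((lowerSemicontinuous_sq hN hN0).add hG).add (hG.comp hi)

lemma exists_strictlyConvexNorm_of_seq {ψ : ℕ → X → ℝ} (h0 : ∀ k x, 0 ≤ ψ k x)
    (hle : ∀ k x, ψ k x ≤ 1 + ‖x‖) (hconv : ∀ k, ConvexOn ℝ Set.univ (ψ k))
    (hsep : ∀ x y, ‖x‖ = ‖y‖ →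
      (∀ k, ψ k x = ψ k y ∧ ψ k y = ψ k ((1 / 2 : ℝ) • (x + y))) → x = y)
    (τ : TopologicalSpace X) (hsmul : ∀ t : ℝ, @Continuous X X τ τ (fun x => t • x))
    (hnorm : @LowerSemicontinuous X ℝ τ _ fun x => ‖x‖)
    (hlsc : ∀ k, @LowerSemicontinuous X ℝ τ _ (ψ k)) :
    ∃ p : Seminorm ℝ X, IsEquivalentNorm p ∧ IsStrictlyConvexNorm p ∧
      @LowerSemicontinuous X ℝ τ _ (fun x => p x) := by
  have hG := convexOn_weightedSqSum h0 hle hconv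
  have hGneg : ConvexOn ℝ Set.univ fun x => weightedSqSum ψ (-x) :=
    hG.comp_linearMap (-LinearMap.id)
  have hN : ConvexOn ℝ Set.univ fun x : X => ‖x‖ ^ 2 :=
    convexOn_univ_norm.pow (fun x _ => norm_nonneg x) 2
  obtain ⟨p, hequiv, hstrict, hsub⟩ := exists_strictlyConvexNorm_of_convexOn
    (Φ := fun x => ‖x‖ ^ 2 + weightedSqSum ψ x + weightedSqSum ψ (-x)) ((hN.add hG).add hGneg)
    (fun x => by simp only [norm_neg, neg_neg]; ring)
    (fun x => by linarith [weightedSqSum_nonneg ψ x, weightedSqSum_nonneg ψ (-x)])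
    (fun x => by
      have h₁ := weightedSqSum_le h0 hle x
      have h₂ := weightedSqSum_le h0 hle (-x)
      rw [norm_neg] at h₂
      linarith)
    (fun x y hxy hm => by
      have h₁ := convexOn_midpoint_le hN x y
      have h₂ := convexOn_midpoint_le hG x y
      have h₃ := convexOn_midpoint_le hGneg x y
      refine hsep x y ?_ fun k => eq_midpoint_of_weightedSqSum h0 hle hconv (by linarith) k
      exact (eq_and_eq_of_sq_add_sq_le (norm_nonneg ((1 / 2 : ℝ) • (x + y)))
        (convexOn_midpoint_le convexOn_univ_norm x y) (by linarith)).1)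
  refine ⟨p, hequiv, hstrict, @lowerSemicontinuous_seminorm_of_sublevel X _ _ τ hsmul
    (fun x => ‖x‖ ^ 2 + weightedSqSum ψ x + weightedSqSum ψ (-x)) ?_ _ p hsub⟩
  refine @lowerSemicontinuous_sq_add_add_comp X τ _ _ _ hnorm (fun x => norm_nonneg x) ?_ ?_
  · exact @lowerSemicontinuous_weightedSqSum X τ _ h0 (summable_weightedSq h0 hle) hlsc
  · simpa using hsmul (-1)

end Sum

/-! ### Convex functions built from half-spaces, and the renorming. -/

section HalfSpaces

variable {X : Type*} [NormedAddCommGroup X] [NormedSpace ℝ X]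

/-- The normalised positive excess of `x` over the half-space `{x | d.2 * t < d.1 x}`. -/
noncomputable def excess (d : StrongDual ℝ X × ℝ) (t : ℝ) (x : X) : ℝ :=
  max 0 ((d.1 x - d.2 * t) / (1 + ‖d.1‖ + |d.2|))

/-- The supremum of the excesses over a set of half-spaces. -/
noncomputable def supExcess (D : Set (StrongDual ℝ X × ℝ)) (t : ℝ) (x : X) : ℝ :=
  ⨆ d : D, excess d.1 t x

lemma excess_nonneg (d : StrongDual ℝ X × ℝ) (t : ℝ) (x : X) : 0 ≤ excess d t x :=
  le_max_left _ _

lemma excess_le (d : StrongDual ℝ X × ℝ) (t : ℝ) (x : X) : excess d t x ≤ ‖x‖ + |t| := by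
  refine max_le (by positivity) ?_
  rw [div_le_iff₀ (by positivity)]
  have h₁ : d.1 x ≤ ‖d.1‖ * ‖x‖ := (le_abs_self _).trans (d.1.le_opNorm x)
  have h₂ : -(d.2 * t) ≤ |d.2| * |t| := by rw [← abs_mul]; exact neg_le_abs _
  nlinarith [norm_nonneg x, norm_nonneg d.1, abs_nonneg d.2, abs_nonneg t,
    mul_nonneg (norm_nonneg d.1) (abs_nonneg t), mul_nonneg (abs_nonneg d.2) (norm_nonneg x)]

lemma excess_le_add_dist (d : StrongDual ℝ X × ℝ) (s t : ℝ) (x : X) :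
    excess d s x ≤ excess d t x + dist s t := by
  refine max_le (add_nonneg (excess_nonneg _ _ _) dist_nonneg) ?_
  have h : (d.1 x - d.2 * s) / (1 + ‖d.1‖ + |d.2|)
      ≤ (d.1 x - d.2 * t) / (1 + ‖d.1‖ + |d.2|) + dist s t := by
    rw [← sub_le_iff_le_add', ← sub_div, div_le_iff₀ (by positivity), Real.dist_eq]
    have : d.2 * (t - s) ≤ |d.2| * |s - t| := by
      rw [abs_sub_comm, ← abs_mul]; exact le_abs_self _
    nlinarith [abs_nonneg (s - t), mul_nonneg (norm_nonneg d.1) (abs_nonneg (s - t))]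
  exact h.trans (add_le_add_left (le_max_right _ _) _)

lemma convexOn_excess (d : StrongDual ℝ X × ℝ) (t : ℝ) : ConvexOn ℝ Set.univ (excess d t) := by
  refine (convexOn_const 0 convex_univ).sup ⟨convex_univ, fun x _ y _ a b _ _ hab => le_of_eq ?_⟩
  simp only [map_add, map_smul, smul_eq_mul]
  obtain rfl : b = 1 - a := by linarith
  ring

variable (D : Set (StrongDual ℝ X × ℝ))

lemma bddAbove_excess (t : ℝ) (x : X) : BddAbove (Set.range fun d : D => excess d.1 t x) :=
  ⟨‖x‖ + |t|, by rintro _ ⟨d, rfl⟩; exact excess_le _ _ _⟩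

lemma excess_le_supExcess {d : StrongDual ℝ X × ℝ} (hd : d ∈ D) (t : ℝ) (x : X) :
    excess d t x ≤ supExcess D t x :=
  le_ciSup (bddAbove_excess D t x) (⟨d, hd⟩ : D)

lemma supExcess_nonneg (t : ℝ) (x : X) : 0 ≤ supExcess D t x :=
  Real.iSup_nonneg fun _ => excess_nonneg _ _ _

lemma supExcess_le (t : ℝ) (x : X) : supExcess D t x ≤ ‖x‖ + |t| :=
  Real.iSup_le (fun _ => excess_le _ _ _) (by positivity)

lemma continuous_supExcess (x : X) : Continuous fun t => supExcess D t x := by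
  refine (LipschitzWith.of_le_add fun s t => ?_).continuous
  exact Real.iSup_le (fun d => (excess_le_add_dist d.1 s t x).trans
    (add_le_add_left (excess_le_supExcess D d.2 t x) _))
    (add_nonneg (supExcess_nonneg D t x) dist_nonneg)

lemma convexOn_supExcess (t : ℝ) : ConvexOn ℝ Set.univ (supExcess D t) := by
  refine ⟨convex_univ, fun x hx y hy a b ha hb hab => ?_⟩
  have hx0 := supExcess_nonneg D t x
  have hy0 := supExcess_nonneg D t y
  refine Real.iSup_le (fun d => ((convexOn_excess d.1 t).2 hx hy ha hb hab).trans ?_)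
    (by simp only [smul_eq_mul]; positivity)
  exact add_le_add (mul_le_mul_of_nonneg_left (excess_le_supExcess D d.2 t x) ha)
    (mul_le_mul_of_nonneg_left (excess_le_supExcess D d.2 t y) hb)

lemma lowerSemicontinuous_supExcess (τ : TopologicalSpace X)
    (hD : ∀ d ∈ D, @Continuous X ℝ τ _ d.1) (t : ℝ) :
    @LowerSemicontinuous X ℝ τ _ (supExcess D t) := by
  refine @lowerSemicontinuous_ciSup X τ D ℝ _ _ (bddAbove_excess D t) fun d => ?_
  have := hD d.1 d.2
  exact @Continuous.lowerSemicontinuous X τ ℝ _ _ _ _ (continuous_const.max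
    ((this.sub continuous_const).div_const _))

variable {D}

lemma excess_pos_iff {d : StrongDual ℝ X × ℝ} {t : ℝ} {x : X} :
    0 < excess d t x ↔ d.2 * t < d.1 x := by
  have : 0 < 1 + ‖d.1‖ + |d.2| := by positivity
  simp [excess, div_pos_iff_of_pos_right this]

lemma exists_mem_both_of_supExcess_eq {t : ℝ} {x y : X} (hxy : supExcess D t x = supExcess D t y)
    (hm : supExcess D t y = supExcess D t ((1 / 2 : ℝ) • (x + y)))
    (h : ∃ d ∈ D, d.2 * t < d.1 x ∨ d.2 * t < d.1 y) :
    ∃ d ∈ D, d.2 * t < d.1 x ∧ d.2 * t < d.1 y := by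
  obtain ⟨d₀, hd₀, hor⟩ := h
  have hpos : 0 < supExcess D t y := by
    rcases hor with h | h
    · exact hxy ▸ (excess_pos_iff.2 h).trans_le (excess_le_supExcess D hd₀ t x)
    · exact (excess_pos_iff.2 h).trans_le (excess_le_supExcess D hd₀ t y)
  have : Nonempty D := ⟨⟨d₀, hd₀⟩⟩
  -- Any factor in `[1/2, 1)` would do: both excesses are at most the supremum, and their mean
  -- exceeds half of it, so neither is 0.
  obtain ⟨⟨d, hd⟩, hlt⟩ := exists_lt_of_lt_ciSup (f := fun d : D =>
    excess d.1 t ((1 / 2 : ℝ) • (x + y))) (b := 3 / 4 * supExcess D t y) (by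
      change _ < supExcess D t ((1 / 2 : ℝ) • (x + y))
      rw [← hm]; linarith)
  have hmid := convexOn_midpoint_le (convexOn_excess d t) x y
  have hx := excess_le_supExcess D hd t x
  have hy := excess_le_supExcess D hd t y
  simp only at hlt
  exact ⟨d, hd, excess_pos_iff.1 (by linarith), excess_pos_iff.1 (by linarith)⟩

variable {F : Submodule ℝ (StrongDual ℝ X)}

lemma continuous_sigmaTopology {f : StrongDual ℝ X} (hf : f ∈ F) :
    @Continuous X ℝ (sigmaTopology F) _ f :=
  continuous_iInf_dom (i := (⟨f, hf⟩ : F)) continuous_induced_dom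

lemma le_sigmaTopology : (inferInstance : TopologicalSpace X) ≤ sigmaTopology F :=
  le_iInf fun f => continuous_iff_le_induced.1 f.1.continuous

lemma isTopologicalAddGroup_sigmaTopology : @IsTopologicalAddGroup X (sigmaTopology F) _ :=
  topologicalAddGroup_iInf fun f => topologicalAddGroup_induced f.1

lemma continuousSMul_sigmaTopology : @ContinuousSMul ℝ X _ _ (sigmaTopology F) :=
  continuousSMul_iInf fun f => continuousSMul_induced f.1

lemma locallyConvexSpace_sigmaTopology : @LocallyConvexSpace ℝ X _ _ _ _ (sigmaTopology F) :=
  LocallyConvexSpace.iInf fun f => LocallyConvexSpace.induced f.1.toLinearMap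

lemma IsOneNorming.lowerSemicontinuous_norm (hF : IsOneNorming F) :
    @LowerSemicontinuous X ℝ (sigmaTopology F) _ fun x => ‖x‖ := by
  intro x a hax
  obtain ⟨_, ⟨f, hf, hf1, rfl⟩, hlt⟩ := (lt_isLUB_iff (hF x)).1 hax
  have hev := (@Continuous.tendsto X ℝ (sigmaTopology F) _ _ (continuous_sigmaTopology hf)
    x).eventually (lt_mem_nhds hlt)
  filter_upwards [hev] with y hy
  exact hy.trans_le ((hF y).1 ⟨f, hf, hf1, rfl⟩)

lemma IsOneNorming.exists_norm_of_halfspaces (hF : IsOneNorming F)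
    (D : ℕ → Set (StrongDual ℝ X × ℝ))
    (hD : ∀ n, ∀ d ∈ D n, @Continuous X ℝ (sigmaTopology F) _ d.1)
    (h : ∀ x y, x ≠ y → ‖x‖ = ‖y‖ → ∃ n, ∃ t : ℝ,
      (∃ d ∈ D n, d.2 * t < d.1 x ∨ d.2 * t < d.1 y) ∧
      ∀ d ∈ D n, ¬ (d.2 * t < d.1 x ∧ d.2 * t < d.1 y)) :
    ∃ p : Seminorm ℝ X, IsEquivalentNorm p ∧ IsStrictlyConvexNorm p ∧
      @LowerSemicontinuous X ℝ (sigmaTopology F) _ (fun x => p x) := by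
  obtain ⟨e, he⟩ := exists_surjective_nat (ℕ × ℚ)
  have hpos : ∀ k, 0 < 1 + |((e k).2 : ℝ)| := fun k => by positivity
  refine exists_strictlyConvexNorm_of_seq
    -- The factor turns the bound `‖x‖ + |t|` into one by `1 + ‖x‖`, uniform in `k`.
    (ψ := fun k x => (1 + |((e k).2 : ℝ)|)⁻¹ * supExcess (D (e k).1) (e k).2 x)
    (fun k x => mul_nonneg (inv_nonneg.2 (hpos k).le) (supExcess_nonneg _ _ _)) (fun k x => ?_)
    (fun k => (convexOn_supExcess _ _).smul (inv_nonneg.2 (hpos k).le)) (fun x y hxy hk => ?_)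
    (sigmaTopology F) (fun t => ?_) hF.lowerSemicontinuous_norm (fun k => ?_)
  · rw [inv_mul_le_iff₀ (hpos k)]
    nlinarith [supExcess_le (D (e k).1) (e k).2 x, norm_nonneg x, abs_nonneg ((e k).2 : ℝ),
      mul_nonneg (norm_nonneg x) (abs_nonneg ((e k).2 : ℝ))]
  · by_contra hne
    obtain ⟨n, t, hex, hall⟩ := h x y hne hxy
    have hq : ∀ q : ℚ, supExcess (D n) q x = supExcess (D n) q y ∧
        supExcess (D n) q y = supExcess (D n) q ((1 / 2 : ℝ) • (x + y)) := fun q => by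
      obtain ⟨k, hek⟩ := he (n, q)
      have hinv := (inv_pos.2 (hpos k)).ne'
      have := hk k
      rw [mul_right_inj' hinv, mul_right_inj' hinv, hek] at this
      exact this
    -- Only rational parameters enter the sum; continuity in `t` recovers the real one.
    have hext : ∀ u v : X, (∀ q : ℚ, supExcess (D n) q u = supExcess (D n) q v) →
        supExcess (D n) t u = supExcess (D n) t v := fun u v huv =>
      congrFun (Rat.denseRange_cast.equalizer (continuous_supExcess (D n) u)
        (continuous_supExcess (D n) v) (funext huv)) t
    obtain ⟨d, hd, hboth⟩ := exists_mem_both_of_supExcess_eq (hext x y fun q => (hq q).1)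
      (hext y _ fun q => (hq q).2) hex
    exact hall d hd hboth
  · exact @ContinuousConstSMul.continuous_const_smul ℝ X (sigmaTopology F) _
      (@ContinuousSMul.continuousConstSMul ℝ X _ (sigmaTopology F) _ continuousSMul_sigmaTopology) t
  · exact @lowerSemicontinuous_const_mul X (sigmaTopology F) _
      (lowerSemicontinuous_supExcess (D (e k).1) (sigmaTopology F) (hD _) _) _
      (inv_nonneg.2 (hpos k).le)

/-- Property (*) with slices of `A`, expressed through half-spaces of the whole space. -/
lemma SigmaHasStarWithSlices.exists_halfspaces {A : Set X} (hA : SigmaHasStarWithSlices F A) :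
    ∃ D : ℕ → Set (StrongDual ℝ X × ℝ),
      (∀ n, ∀ d ∈ D n, @Continuous X ℝ (sigmaTopology F) _ d.1) ∧
      ∀ x ∈ A, ∀ y ∈ A, x ≠ y → ∃ n, (∃ d ∈ D n, d.2 < d.1 x ∨ d.2 < d.1 y) ∧
        ∀ d ∈ D n, ¬ (d.2 < d.1 x ∧ d.2 < d.1 y) := by
  obtain ⟨U, ⟨-, hU⟩, hslice⟩ := hA
  refine ⟨fun n => {d | @Continuous X ℝ (sigmaTopology F) _ d.1 ∧ {a : A | d.2 < d.1 a} ∈ U n},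
    fun n d hd => hd.1, fun x hx y hy hxy => ?_⟩
  have hne : (⟨x, hx⟩ : A) ≠ ⟨y, hy⟩ := fun h => hxy (Subtype.mk.inj h)
  obtain ⟨n, ⟨z, hz, V, hV, hzV⟩, hsub⟩ := hU _ _ hne
  refine ⟨n, ?_, fun d hd hboth => hne (hsub _ hd.2 ⟨Or.inl rfl, hboth.1⟩ ⟨Or.inr rfl, hboth.2⟩)⟩
  obtain ⟨f, -, r, rfl⟩ := hslice n V hV
  have hf := @ContinuousLinearMap.cont _ _ _ _ _ _ (sigmaTopology F) _ _ _ _ _ _ f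
  -- As `σ(X, F)` is coarser than the norm topology, `f` is also norm continuous.
  refine ⟨(⟨@ContinuousLinearMap.toLinearMap _ _ _ _ _ _ (sigmaTopology F) _ _ _ _ _ _ f,
    continuous_le_dom le_sigmaTopology hf⟩, r), ⟨hf, hV⟩, ?_⟩
  rcases hz with rfl | rfl
  · exact Or.inl hzV
  · exact Or.inr hzV

lemma IsOneNorming.exists_norm_of_sphere (hF : IsOneNorming F)
    (hS : SigmaHasStarWithSlices F (Metric.sphere (0 : X) 1)) :
    ∃ p : Seminorm ℝ X, IsEquivalentNorm p ∧ IsStrictlyConvexNorm p ∧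
      @LowerSemicontinuous X ℝ (sigmaTopology F) _ (fun x => p x) := by
  obtain ⟨D, hD, hsep⟩ := hS.exists_halfspaces
  refine hF.exists_norm_of_halfspaces D hD fun x y hxy hnorm => ?_
  have hy0 : 0 < ‖y‖ := by
    refine lt_of_le_of_ne (norm_nonneg y) fun h => hxy ?_
    rw [norm_eq_zero.1 (hnorm.trans h.symm), norm_eq_zero.1 h.symm]
  have hmem : ∀ z : X, ‖z‖ = ‖y‖ → ‖y‖⁻¹ • z ∈ Metric.sphere (0 : X) 1 := fun z hz => by
    rw [mem_sphere_zero_iff_norm, norm_smul, norm_inv, norm_norm, hz, inv_mul_cancel₀ hy0.ne']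
  obtain ⟨n, hex, hall⟩ := hsep _ (hmem x hnorm) _ (hmem y rfl)
    fun h => hxy (smul_right_injective X (inv_ne_zero hy0.ne') h)
  have hiff : ∀ (d : StrongDual ℝ X × ℝ) (z : X),
      d.2 < d.1 (‖y‖⁻¹ • z) ↔ d.2 * ‖y‖ < d.1 z := fun d z => by
    rw [map_smul, smul_eq_mul, lt_inv_mul_iff₀ hy0, mul_comm]
  simp only [hiff] at hex hall
  exact ⟨n, ‖y‖, hex, hall⟩

lemma IsOneNorming.exists_norm_of_cover (hF : IsOneNorming F) {A : ℕ → Set X}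
    (hcov : {z : X × X | z.1 ≠ z.2} ⊆ ⋃ n, A n ×ˢ A n)
    (hA : ∀ n, SigmaHasStarWithSlices F (A n)) :
    ∃ p : Seminorm ℝ X, IsEquivalentNorm p ∧ IsStrictlyConvexNorm p ∧
      @LowerSemicontinuous X ℝ (sigmaTopology F) _ (fun x => p x) := by
  choose D hD hsep using fun n => (hA n).exists_halfspaces
  refine hF.exists_norm_of_halfspaces (fun k => D k.unpair.1 k.unpair.2)
    (fun k => hD _ _) fun x y hxy _ => ?_
  obtain ⟨m, hx, hy⟩ := Set.mem_iUnion.1 (hcov (show (x, y) ∈ {z : X × X | z.1 ≠ z.2} from hxy))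
  obtain ⟨n, h⟩ := hsep m x hx y hy hxy
  refine ⟨Nat.pair m n, 1, ?_⟩
  simpa only [Nat.unpair_pair, mul_one] using h

end HalfSpaces

end StarRenorming

theorem mainTheorem1 {X : Type*} [NormedAddCommGroup X] [NormedSpace ℝ X] [CompleteSpace X]
    (F : Submodule ℝ (StrongDual ℝ X)) (hF : StarRenorming.IsOneNorming F) :
    List.TFAE [
      ∃ p : Seminorm ℝ X, StarRenorming.IsEquivalentNorm p ∧
        StarRenorming.IsStrictlyConvexNorm p ∧
        @LowerSemicontinuous X ℝ (StarRenorming.sigmaTopology F) _ (fun x => p x),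
      StarRenorming.SigmaHasStarWithSlices F (Set.univ : Set X),
      StarRenorming.SigmaHasStarWithSlices F (Metric.sphere (0 : X) 1),
      ∃ A : ℕ → Set X,
        {z : X × X | z.1 ≠ z.2} ⊆ ⋃ n, A n ×ˢ A n ∧
        ∀ n, StarRenorming.SigmaHasStarWithSlices F (A n)] := by
  tfae_have 1 → 2 := fun ⟨p, _, hstrict, hlsc⟩ =>
    @StarRenorming.hasStarWithSlices_univ_of_seminorm X _ _ (StarRenorming.sigmaTopology F)
      StarRenorming.isTopologicalAddGroup_sigmaTopology
      StarRenorming.continuousSMul_sigmaTopology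
      StarRenorming.locallyConvexSpace_sigmaTopology p hlsc hstrict
  tfae_have 2 → 3 := fun h =>
    @StarRenorming.HasStarWithSlices.mono X _ _ (StarRenorming.sigmaTopology F) _ _
      (Set.subset_univ _) h
  tfae_have 2 → 4 := fun h =>
    ⟨fun _ => Set.univ, fun z _ => Set.mem_iUnion.2 ⟨0, trivial, trivial⟩, fun _ => h⟩
  tfae_have 3 → 1 := hF.exists_norm_of_sphere
  tfae_have 4 → 1 := fun ⟨_, hcov, hA⟩ => hF.exists_norm_of_cover hcov hA
  tfae_finish
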